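/- Let $P$ be a finite poset, let $L=\mathcal J(P)$ be the finite distributive lattice of its order ideals (down-closed subsets, including $\emptyset$ and $P$) ordered by inclusion, and let $K$ be a field. Let $\hat 0=\emptyset$ and $\hat 1=P$ be the least and greatest elements of $L$. The chain algebra $K[\mathcal C_L]$ is the $K$-subalgebra of the polynomial ring $K[t_x : x\in L\setminus\{\hat 0,\hat 1\}]$ generated by the monomials $t_C=\prod_{x\in C\setminus\{\hat 0,\hat 1\}}t_x$, where $C$ runs over all maximal chains of $L$. (a) If $|P|\ge 2$, then the Krull dimension of the chain algebra is $\dim K[\mathcal C_L]=|L|-|P|$. (b) For every finite poset $P$ (with $|P|\le 1$ allowed), the variant of the chain algebra that keeps $\hat 0$ and $\hat 1$, that is, the $K$-subalgebra of $K[t_x : x\in L]$ generated by the monomials $\prod_{x\in C}t_x$ for all maximal chains $C$ of $L$, has Krull dimension $|L|-|P|$. -/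

import Mathlib

/-- The elements of a bounded order other than the least and the greatest one. -/
abbrev InnerElement (L : Type*) [DistribLattice L] [BoundedOrder L] : Type _ :=
  {x : L // x ≠ ⊥ ∧ x ≠ ⊤}

/-- The monomial `t_C` of a maximal chain `C` of `L`: the product of the variables of the
elements of `C`, the least and the greatest element of `L` being left out. -/
noncomputable def chainMonomial (K : Type*) [Field K] {L : Type*} [DistribLattice L]
    [BoundedOrder L] [Finite L] (C : Flag L) : MvPolynomial (InnerElement L) K :=
  ∏ x ∈ (Set.toFinite {x : InnerElement L | (x : L) ∈ C}).toFinset, MvPolynomial.X x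

/-- The chain algebra `K[C_L]`: the `K`-subalgebra generated by the monomials `t_C` of all
maximal chains `C` of the finite distributive lattice `L`. -/
noncomputable def chainAlgebra (K : Type*) [Field K] (L : Type*) [DistribLattice L]
    [BoundedOrder L] [Finite L] : Subalgebra K (MvPolynomial (InnerElement L) K) :=
  Algebra.adjoin K (Set.range fun C : Flag L => chainMonomial K C)

/-- The monomial of a maximal chain `C` of `L` with all elements of `C` kept. -/
noncomputable def fullChainMonomial (K : Type*) [Field K] {L : Type*} [DistribLattice L]
    [Finite L] (C : Flag L) : MvPolynomial L K :=
  ∏ x ∈ (Set.toFinite {x : L | x ∈ C}).toFinset, MvPolynomial.X x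

/-- The variant of the chain algebra in which the variables of the least and the greatest
element of `L` are kept. -/
noncomputable def fullChainAlgebra (K : Type*) [Field K] (L : Type*) [DistribLattice L]
    [Finite L] : Subalgebra K (MvPolynomial L K) :=
  Algebra.adjoin K (Set.range fun C : Flag L => fullChainMonomial K C)

/-!
The Krull dimension of a finitely generated domain over a field is its transcendence degree (Noether
normalization, together with the invariance of dimension under integral extensions), so it suffices
to compute the transcendence degree of the chain algebra. Both parts are instances of one statement
about squarefree monomials, `ringKrullDim_monomialSubalgebra`.

Let the variables be indexed by `ι`, graded by `r : ι → ρ`, and let `A` be generated by the monomials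
of a family of transversals of the fibres of `r`. Fix one transversal `c₀`, meeting the fibre over
`j` in `s j`.

* In the fraction field, the monomial of any transversal `c` equals
  `∏_{x ∈ c} t_x / t_{s (r x)}` times the monomial of `c₀`. Hence `A` lies in an algebra generated
  by `|ι| - |ρ| + 1` elements, and `trdeg A ≤ |ι| - |ρ| + 1`
  (`trdeg_monomialSubalgebra_le`).
* If two transversals differ only in that one contains `x` where the other contains `y`, then
  `t_x / t_y` is a quotient of elements of `A`. If such exchanges connect every fibre, then the
  polynomial ring is algebraic over `A[t_x : x ∈ c₀ \ {z}]` for any `z ∈ c₀`, so that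
  `trdeg A ≥ |ι| - (|ρ| - 1)` (`le_trdeg_monomialSubalgebra`).

In the lattice of lower sets of `P`, graded by cardinality, a maximal chain contains exactly one lower
set of each cardinality from `0` to `|P|` (`Flag.existsUnique_ncard_eq`). Two lower sets of the same
cardinality are connected by steps that add one element and remove another one; each step takes place
inside an interval of length two and is an exchange between two maximal chains
(`reflTransGen_flagSwap_of_ncard_eq`). So the dimension is `|L| - (|P| + 1) + 1` when all variables
are kept, and `(|L| - 2) - (|P| - 1) + 1` when those of the two extreme elements are left out.
-/

/-! ### Krull dimension and transcendence degree -/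

theorem ringKrullDim_eq_of_isIntegral {R S : Type*} [CommRing R] [CommRing S] [Algebra R S]
    [Algebra.IsIntegral R S] [FaithfulSMul R S] : ringKrullDim S = ringKrullDim R := by
  apply le_antisymm
  · exact Order.krullDim_le_of_strictMono (PrimeSpectrum.comap (algebraMap R S))
      fun _ _ h => Ideal.IsIntegral.comap_lt_comap h
  · refine iSup_le fun l => ?_
    obtain ⟨Q, hQ, hQl⟩ := (inferInstance : Nonempty (l.head.asIdeal.primesOver S))
    obtain ⟨L, hL, -, -⟩ := Ideal.exists_ltSeries_of_hasGoingUp l Q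
    rw [← hL]
    exact Order.LTSeries.length_le_krullDim L

/-- The Krull dimension of a finitely generated domain over a field is its transcendence degree. -/
theorem ringKrullDim_eq_of_trdeg_eq (K R : Type*) [Field K] [CommRing R] [IsDomain R]
    [Algebra K R] [Algebra.FiniteType K R] {d : ℕ} (h : Algebra.trdeg K R = d) :
    ringKrullDim R = d := by
  obtain ⟨s, g, hg, hint⟩ := exists_integral_inj_algHom_of_fg K R
  algebraize [g.toRingHom]
  have : FaithfulSMul (MvPolynomial (Fin s) K) R :=
    (faithfulSMul_iff_algebraMap_injective _ _).mpr hg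
  have : IsScalarTower K (MvPolynomial (Fin s) K) R :=
    .of_algebraMap_eq fun x => (g.commutes x).symm
  have key := lift_trdeg_add_eq K (MvPolynomial (Fin s) K) R
  rw [trdeg_eq_zero (R := MvPolynomial (Fin s) K), h] at key
  have hs : s = d := by simpa using key
  rw [ringKrullDim_eq_of_isIntegral (R := MvPolynomial (Fin s) K),
    MvPolynomial.ringKrullDim_of_isNoetherianRing, ringKrullDim_eq_zero_of_field, zero_add, hs]
  simp

/-! ### Algebras generated by monomials of transversals -/

section SquarefreeMonomials

open MvPolynomial

variable {K ι ρ κ : Type*} [Field K] [Fintype ρ] {r : ι → ρ} {c : κ → Finset ι}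

/-- A product of values that depend only on the fibre is the same over all transversals. -/
theorem prod_comp_eq_of_existsUnique_fiber {M : Type*} [CommMonoid M] {s : Finset ι}
    (hs : ∀ j, ∃! x, x ∈ s ∧ r x = j) (f : ρ → M) : ∏ x ∈ s, f (r x) = ∏ j, f j := by
  refine Finset.prod_bij (fun x _ => r x) (by simp) (fun x hx y hy h => ?_) (fun j _ => ?_)
    (by simp)
  · exact (hs (r y)).unique ⟨hx, h⟩ ⟨hy, rfl⟩
  · obtain ⟨x, hx, -⟩ := hs j
    exact ⟨x, hx.1, hx.2⟩

theorem card_eq_of_existsUnique_fiber {s : Finset ι}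
    (hs : ∀ j, ∃! x, x ∈ s ∧ r x = j) : s.card = Fintype.card ρ := by
  have := prod_comp_eq_of_existsUnique_fiber hs (fun _ => Multiplicative.ofAdd 1)
  simpa [← ofAdd_nsmul] using this

variable (K c) in
/-- The subalgebra of the polynomial ring generated by the squarefree monomials whose supports are the
sets `c k`. -/
noncomputable abbrev monomialSubalgebra : Subalgebra K (MvPolynomial ι K) :=
  Algebra.adjoin K (Set.range fun k => ∏ x ∈ c k, X x)

variable [Fintype ι] [DecidableEq ι]

/-- Upper bound: in the fraction field, all the generators are polynomials in one generator and the
`|ι| - |ρ|` ratios of a variable outside its support to the variable of the support in the same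
fibre. -/
theorem trdeg_monomialSubalgebra_le (hc : ∀ k j, ∃! x, x ∈ c k ∧ r x = j) (k₀ : κ) :
    Algebra.trdeg K (monomialSubalgebra K c) + Fintype.card ρ ≤ Fintype.card ι + 1 := by
  choose s hs using fun j => (hc k₀ j).exists
  let E := FractionRing (MvPolynomial ι K)
  let T : ι → E := fun x => algebraMap (MvPolynomial ι K) E (X x)
  have hT : ∀ x, T x ≠ 0 := fun x => by simp [T]
  -- `none` stands for the monomial of `c k₀`, and `some x` for the ratio belonging to `x`.
  let g : Option {x // x ∉ c k₀} → E :=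
    fun o => o.elim (∏ j, T (s j)) fun x => T x / T (s (r x))
  -- For `x ∈ c k₀` the ratio is `1`; the other ratios are among the generators.
  have hmem : ∀ x, T x / T (s (r x)) ∈ (aeval (R := K) g).range := by
    intro x
    by_cases hx : x ∈ c k₀
    · rw [(hc k₀ (r x)).unique (hs (r x)) ⟨hx, rfl⟩, div_self (hT x)]
      exact one_mem _
    · exact ⟨X (some ⟨x, hx⟩), by simp [g]⟩
  have hle : ∀ a : monomialSubalgebra K c,
      algebraMap (MvPolynomial ι K) E a ∈ (aeval (R := K) g).range := by
    suffices monomialSubalgebra K c ≤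
        (aeval (R := K) g).range.comap (IsScalarTower.toAlgHom K (MvPolynomial ι K) E) from
      fun a => this a.2
    refine Algebra.adjoin_le ?_
    rintro _ ⟨k, rfl⟩
    change algebraMap (MvPolynomial ι K) E (∏ x ∈ c k, X x) ∈ (aeval (R := K) g).range
    have : algebraMap (MvPolynomial ι K) E (∏ x ∈ c k, X x) =
        (∏ x ∈ c k, T x / T (s (r x))) * ∏ j, T (s j) := by
      rw [map_prod, ← prod_comp_eq_of_existsUnique_fiber (hc k) fun j => T (s j),
        ← Finset.prod_mul_distrib]
      exact Finset.prod_congr rfl fun x _ => (div_mul_cancel₀ _ (hT _)).symm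
    rw [this]
    exact mul_mem (prod_mem fun x _ => hmem x) ⟨X none, by simp [g]⟩
  let φ : monomialSubalgebra K c →ₐ[K] (aeval (R := K) g).range :=
    ((IsScalarTower.toAlgHom K (MvPolynomial ι K) E).comp
      (monomialSubalgebra K c).val).codRestrict _ hle
  have hφ : Function.Injective φ := by
    intro a b hab
    apply Subtype.ext
    exact IsFractionRing.injective (MvPolynomial ι K) E (congrArg Subtype.val hab)
  have h1 := trdeg_le_of_injective φ hφ
  have h2 := lift_trdeg_le_of_surjective (aeval (R := K) g).rangeRestrict
    (aeval (R := K) g).rangeRestrict_surjective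
  have hcard : Fintype.card (Option {x // x ∉ c k₀}) + Fintype.card ρ = Fintype.card ι + 1 := by
    have := card_eq_of_existsUnique_fiber (hc k₀)
    have h3 := Fintype.card_subtype_compl (fun x => x ∈ c k₀)
    have h4 := (c k₀).card_le_univ
    simp only [Fintype.card_option, Fintype.card_coe] at h3 ⊢
    omega
  rw [MvPolynomial.trdeg_of_isDomain, Cardinal.mk_fintype] at h2
  have h2' : Algebra.trdeg K (aeval (R := K) g).range ≤
      (Fintype.card (Option {x // x ∉ c k₀}) : Cardinal) := by
    simpa using h2
  calc _ ≤ ((Fintype.card (Option {x // x ∉ c k₀}) : Cardinal)) + Fintype.card ρ := by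
        gcongr; exact h1.trans h2'
    _ = _ := by exact_mod_cast hcard

/-- Lower bound: if exchanges of one element between transversals connect every fibre, then adjoining
`|ρ| - 1` variables makes the polynomial ring algebraic over the monomial algebra. -/
theorem le_trdeg_monomialSubalgebra (hc : ∀ k j, ∃! x, x ∈ c k ∧ r x = j) (k₀ : κ) (j₀ : ρ)
    (hconn : ∀ x y, r x = r y → Relation.ReflTransGen
      (fun x y => ∃ k l, x ∈ c k ∧ y ∈ c l ∧ (c k).erase x = (c l).erase y) x y) :
    (Fintype.card ι + 1 : Cardinal) ≤
    Algebra.trdeg K (monomialSubalgebra K c) + Fintype.card ρ := by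
  obtain ⟨z, ⟨hz, -⟩, -⟩ := hc k₀ j₀
  let A := monomialSubalgebra K c
  let S : Set (MvPolynomial ι K) := (fun x => X x) '' ((c k₀).erase z : Set ι)
  let M := Algebra.adjoin A S
  have hgen : ∀ k, IsAlgebraic M (∏ x ∈ c k, X x : MvPolynomial ι K) := fun k =>
    isAlgebraic_algebraMap (⟨_, Subalgebra.algebraMap_mem M
      (⟨_, Algebra.subset_adjoin ⟨k, rfl⟩⟩ : A)⟩ : M)
  have hne : ∀ s : Finset ι, (∏ x ∈ s, X x : MvPolynomial ι K) ∈ nonZeroDivisors _ := fun s =>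
    mem_nonZeroDivisors_of_ne_zero (Finset.prod_ne_zero_iff.mpr fun x _ => X_ne_zero x)
  have herase : ∀ x ∈ (c k₀).erase z, IsAlgebraic M (X x : MvPolynomial ι K) := fun x hx =>
    isAlgebraic_algebraMap (⟨_, Algebra.subset_adjoin ⟨x, hx, rfl⟩⟩ : M)
  have hbase : ∀ x ∈ c k₀, IsAlgebraic M (X x : MvPolynomial ι K) := by
    intro x hx
    by_cases hxz : x = z
    · subst hxz
      -- The variable of `z` is the generator of `c k₀` divided by the adjoined variables.
      refine IsAlgebraic.of_mul (hne ((c k₀).erase x)) ?_ ?_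
      · exact prod_mem (S := Subalgebra.algebraicClosure M (MvPolynomial ι K)) herase
      · rw [Finset.prod_erase_mul _ _ hz]
        exact hgen k₀
    · exact herase x (Finset.mem_erase.mpr ⟨hxz, hx⟩)
  have hstep : ∀ x y, (∃ k l, x ∈ c k ∧ y ∈ c l ∧ (c k).erase x = (c l).erase y) →
      IsAlgebraic M (X x : MvPolynomial ι K) → IsAlgebraic M (X y : MvPolynomial ι K) := by
    rintro x y ⟨k, l, hx, hy, h⟩ hX
    -- The exchange relation: `t_{c k} * t_y = t_{c l} * t_x`.
    refine IsAlgebraic.of_mul (hne (c k)) (hgen k) ?_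
    rw [← Finset.prod_erase_mul _ _ hx, h, mul_right_comm, Finset.prod_erase_mul _ _ hy]
    exact (hgen l).mul hX
  have hall : ∀ x, IsAlgebraic M (X x : MvPolynomial ι K) := by
    intro x
    obtain ⟨y, ⟨hy, hyx⟩, -⟩ := hc k₀ (r x)
    have hb := hbase y hy
    have hyx' := hconn y x hyx
    clear hyx
    induction hyx' with
    | refl => exact hb
    | tail _ h ih => exact hstep _ _ h ih
  have halg : Algebra.IsAlgebraic M (MvPolynomial ι K) := by
    refine ⟨fun p => ?_⟩
    induction p using MvPolynomial.induction_on with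
    | C a => exact isAlgebraic_algebraMap (algebraMap K M a)
    | add p q hp hq => exact hp.add hq
    | mul_X p x hp => exact hp.mul (hall x)
  have h1 : Algebra.trdeg A (MvPolynomial ι K) ≤ _ := Algebra.IsAlgebraic.trdeg_le_cardinalMk A S
  have h2 : Cardinal.mk S ≤ ((c k₀).erase z).card :=
    Cardinal.lift_le_nat_iff.mp
      (Cardinal.mk_image_le_lift.trans
        (Cardinal.lift_le_nat_iff.mpr (Cardinal.mk_coe_finset (s := (c k₀).erase z)).le))
  have h3 := trdeg_add_eq K A (A := MvPolynomial ι K)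
  rw [MvPolynomial.trdeg_of_isDomain] at h3
  have h4 : ((c k₀).erase z).card + 1 = Fintype.card ρ := by
    rw [Finset.card_erase_add_one hz, card_eq_of_existsUnique_fiber (hc k₀)]
  rw [Cardinal.mk_fintype, Cardinal.lift_natCast] at h3
  rw [← h3, ← h4]
  push_cast
  rw [← add_assoc]
  gcongr
  exact h1.trans h2

/-- The subtraction does not truncate: the fibres of `r` are nonempty, so `|ρ| ≤ |ι|`. -/
theorem ringKrullDim_monomialSubalgebra [Nonempty κ] [Nonempty ρ]
    (hc : ∀ k j, ∃! x, x ∈ c k ∧ r x = j)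
    (hconn : ∀ x y, r x = r y → Relation.ReflTransGen
      (fun x y => ∃ k l, x ∈ c k ∧ y ∈ c l ∧ (c k).erase x = (c l).erase y) x y) :
    ringKrullDim (monomialSubalgebra K c) = (Fintype.card ι + 1 - Fintype.card ρ : ℕ) := by
  obtain ⟨k₀⟩ := ‹Nonempty κ›
  obtain ⟨j₀⟩ := ‹Nonempty ρ›
  have h1 := trdeg_monomialSubalgebra_le (K := K) hc k₀
  have h2 := le_trdeg_monomialSubalgebra (K := K) hc k₀ j₀ hconn
  have : Algebra.FiniteType K (monomialSubalgebra K c) :=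
    (Subalgebra.fg_iff_finiteType _).mp (Subalgebra.fg_def.mpr
      ⟨_, Set.Finite.subset (Set.finite_range fun s : Finset ι => ∏ x ∈ s, X x)
        (Set.range_comp_subset_range c fun s => ∏ x ∈ s, X x), rfl⟩)
  refine ringKrullDim_eq_of_trdeg_eq K _ ?_
  obtain ⟨d, hd⟩ := Cardinal.lt_aleph0.mp
    ((le_self_add.trans h1).trans_lt (by exact_mod_cast Cardinal.natCast_lt_aleph0))
  rw [hd] at h1 h2 ⊢
  norm_cast at h1 h2 ⊢
  omega

end SquarefreeMonomials

/-! ### Maximal chains of lower sets -/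

section LowerSet

variable {P : Type*} [PartialOrder P] [Finite P]

theorem LowerSet.ncard_strictMono : StrictMono fun I : LowerSet P => (I : Set P).ncard :=
  fun _ _ h => Set.ncard_lt_ncard h

/-- A minimal element of `J \ I` can be added to the lower set `I`. -/
theorem LowerSet.exists_coe_eq_insert {I J : LowerSet P} (h : ¬ J ≤ I) :
    ∃ a ∈ J, a ∉ I ∧ ∃ I' : LowerSet P, (I' : Set P) = insert a (I : Set P) := by
  obtain ⟨a, ⟨haJ, haI⟩, ha⟩ := (Set.toFinite ((J : Set P) \ I)).exists_minimal
    (Set.sdiff_nonempty.mpr h)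
  refine ⟨a, haJ, haI, ⟨insert a (I : Set P), ?_⟩, rfl⟩
  rintro x y hyx (rfl | hx)
  · by_cases hy : y ∈ I
    · exact Or.inr hy
    · exact Or.inl (le_antisymm hyx (ha ⟨J.lower hyx haJ, hy⟩ hyx))
  · exact Or.inr (I.lower hyx hx)

/-- A maximal element of `I \ J` can be removed from the lower set `I`. -/
theorem LowerSet.exists_coe_eq_diff {I J : LowerSet P} (h : ¬ I ≤ J) :
    ∃ b ∈ I, b ∉ J ∧ ∃ I' : LowerSet P, (I' : Set P) = (I : Set P) \ {b} := by
  obtain ⟨b, ⟨hbI, hbJ⟩, hb⟩ := (Set.toFinite ((I : Set P) \ J)).exists_maximal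
    (Set.sdiff_nonempty.mpr h)
  refine ⟨b, hbI, hbJ, ⟨(I : Set P) \ {b}, ?_⟩, rfl⟩
  rintro x y hyx ⟨hx, hxb⟩
  refine ⟨I.lower hyx hx, ?_⟩
  rintro rfl
  exact hxb (le_antisymm (hb ⟨hx, fun hxJ => hbJ (J.lower hyx hxJ)⟩ hyx) hyx)

theorem Flag.mem_of_forall_le_or_le {α : Type*} [Preorder α] (C : Flag α) {a : α}
    (h : ∀ x ∈ C, x ≤ a ∨ a ≤ x) : a ∈ C := by
  have := C.max_chain' (s := insert a (C : Set α))
    (C.chain_le.insert fun x hx _ => (h x hx).symm) (Set.subset_insert _ _)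
  change a ∈ C.carrier
  rw [this]
  exact Set.mem_insert _ _

theorem Flag.le_of_ncard_le (C : Flag (LowerSet P)) {I J : LowerSet P} (hI : I ∈ C) (hJ : J ∈ C)
    (h : (I : Set P).ncard ≤ (J : Set P).ncard) : I ≤ J := by
  rcases C.le_or_le hI hJ with h' | h'
  · exact h'
  · exact (h'.eq_of_not_lt fun hlt => (LowerSet.ncard_strictMono hlt).not_ge h).ge

/-- Maximal chains skip no cardinality: between two members with a gap in cardinality one could
insert the smaller one enlarged by a single element. -/
theorem Flag.exists_mem_ncard_eq (C : Flag (LowerSet P)) (k : ℕ) (hk : k ≤ Nat.card P) :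
    ∃ I ∈ C, (I : Set P).ncard = k := by
  induction k with
  | zero => exact ⟨⊥, C.bot_mem, by simp⟩
  | succ k ih =>
    obtain ⟨I, hI, hIk⟩ := ih (by omega)
    obtain ⟨J, ⟨hJ, hkJ⟩, hmin⟩ := (Set.toFinite {J | J ∈ C ∧ k < (J : Set P).ncard}).exists_minimal
      ⟨⊤, C.top_mem, by simpa [Set.ncard_univ] using hk⟩
    have hIJ : I ≤ J := C.le_of_ncard_le hI hJ (by omega)
    obtain ⟨a, haJ, haI, I', hI'⟩ := LowerSet.exists_coe_eq_insert (I := I) (J := J)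
      (fun h => by
        have := Set.ncard_le_ncard (s := (J : Set P)) (t := I) h
        omega)
    have hII' : I ≤ I' := by
      change (I : Set P) ⊆ I'
      rw [hI']; exact Set.subset_insert _ _
    have hI'J : I' ≤ J := by
      change (I' : Set P) ⊆ J
      rw [hI']; exact Set.insert_subset haJ hIJ
    refine ⟨I', C.mem_of_forall_le_or_le fun x hx => ?_, ?_⟩
    · by_cases hxk : (x : Set P).ncard ≤ k
      · exact Or.inl ((C.le_of_ncard_le hx hI (by omega)).trans hII')
      · refine Or.inr (hI'J.trans ?_)
        rcases C.le_or_le hJ hx with h | h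
        · exact h
        · exact hmin ⟨hx, by omega⟩ h
    · rw [hI', Set.ncard_insert_of_notMem haI, hIk]

theorem Flag.existsUnique_ncard_eq (C : Flag (LowerSet P)) {k : ℕ} (hk : k ≤ Nat.card P) :
    ∃! I, I ∈ C ∧ (I : Set P).ncard = k := by
  obtain ⟨I, hI, hIk⟩ := C.exists_mem_ncard_eq k hk
  exact ⟨I, ⟨hI, hIk⟩, fun J hJ => le_antisymm (C.le_of_ncard_le hJ.1 hI (by omega))
    (C.le_of_ncard_le hI hJ.1 (by omega))⟩

/-- Two elements are exchangeable if some maximal chain through `x` becomes a maximal chain through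
`y` when `x` is replaced by `y`. -/
def FlagSwap {α : Type*} [LE α] (x y : α) : Prop :=
  ∃ C D : Flag α, x ∈ C ∧ y ∈ D ∧ (C : Set α) \ {x} = (D : Set α) \ {y}

/-- Two lower sets of the same cardinality in the interior of an interval `[A, B]` of length two are
exchangeable. -/
theorem flagSwap_of_le_of_le {I I' A B : LowerSet P} (hAI : A ≤ I) (hAI' : A ≤ I') (hIB : I ≤ B)
    (hI'B : I' ≤ B) (hA : (A : Set P).ncard + 1 = (I : Set P).ncard)
    (hB : (B : Set P).ncard = (I : Set P).ncard + 1)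
    (hI' : (I' : Set P).ncard = (I : Set P).ncard) : FlagSwap I I' := by
  have hch : IsChain (· ≤ ·) ({A, I, B} : Set (LowerSet P)) := by
    refine IsChain.insert (IsChain.insert (by simp) ?_) ?_
    · rintro x rfl -
      exact Or.inl hIB
    · rintro x (rfl | rfl) -
      exacts [Or.inl hAI, Or.inl (hAI.trans hIB)]
  obtain ⟨C, hC⟩ := hch.exists_subset_flag
  have hAC : A ∈ C := hC (by simp)
  have hIC : I ∈ C := hC (by simp)
  have hBC : B ∈ C := hC (by simp)
  have hne : ∀ x ∈ C, x ≠ I → (x : Set P).ncard ≠ (I : Set P).ncard := fun x hx hxI h =>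
    hxI (le_antisymm (C.le_of_ncard_le hx hIC h.le) (C.le_of_ncard_le hIC hx h.ge))
  have hch' : IsChain (· ≤ ·) (insert I' ((C : Set (LowerSet P)) \ {I})) := by
    refine (C.chain_le.mono Set.sdiff_subset).insert fun x hx _ => ?_
    rcases (hne x hx.1 hx.2).lt_or_gt with h | h
    · exact Or.inr ((C.le_of_ncard_le hx.1 hAC (by omega)).trans hAI')
    · exact Or.inl (hI'B.trans (C.le_of_ncard_le hBC hx.1 (by omega)))
  -- `D` contains `C \ {I}` and `I'`; as both flags have one member of each cardinality, nothing else.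
  obtain ⟨D, hD⟩ := hch'.exists_subset_flag
  have hI'D : I' ∈ D := hD (Set.mem_insert _ _)
  have hCD : ∀ x ∈ C, x ≠ I → x ∈ D := fun x hx hxI => hD (Set.mem_insert_of_mem _ ⟨hx, hxI⟩)
  refine ⟨C, D, hIC, hI'D, Set.Subset.antisymm ?_ ?_⟩
  · rintro x ⟨hx, hxI⟩
    refine ⟨hCD x hx hxI, ?_⟩
    rintro rfl
    exact hne x hx hxI hI'
  · rintro x ⟨hx, hxI'⟩
    have hcard : (x : Set P).ncard ≤ Nat.card P := Set.ncard_le_card _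
    obtain ⟨y, hy, hyx⟩ := C.exists_mem_ncard_eq _ hcard
    by_cases hyI : y = I
    · subst hyI
      exact absurd ((D.existsUnique_ncard_eq hcard).unique ⟨hx, rfl⟩ ⟨hI'D, by omega⟩) hxI'
    · obtain rfl := (D.existsUnique_ncard_eq hcard).unique ⟨hx, rfl⟩ ⟨hCD y hy hyI, hyx⟩
      exact ⟨hy, hyI⟩

/-- Any two lower sets `I`, `J` of the same cardinality are connected by exchanges. The step from `I`
adds a minimal element of `J \ I` and removes a maximal element of `I \ J`, which makes `J \ I`
smaller. -/
theorem reflTransGen_flagSwap_of_ncard_eq {I J : LowerSet P}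
    (h : (I : Set P).ncard = (J : Set P).ncard) : Relation.ReflTransGen FlagSwap I J := by
  induction hn : ((J : Set P) \ I).ncard using Nat.strong_induction_on generalizing I with
  | _ n ih =>
  by_cases hIJ : I = J
  · rw [hIJ]
  have hJI : ¬ J ≤ I := fun hle => hIJ
    (hle.eq_of_not_lt fun hlt => (LowerSet.ncard_strictMono hlt).ne h.symm).symm
  have hIJ' : ¬ I ≤ J := fun hle => hIJ
    (hle.eq_of_not_lt fun hlt => (LowerSet.ncard_strictMono hlt).ne h)
  obtain ⟨a, haJ, haI, B, hB⟩ := LowerSet.exists_coe_eq_insert hJI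
  obtain ⟨b, hbI, hbJ, A, hA⟩ := LowerSet.exists_coe_eq_diff hIJ'
  have hI'low : IsLowerSet (insert a (A : Set P)) := by
    rintro x y hyx (rfl | hx)
    · have hyB : y ∈ (B : Set P) := B.lower hyx (by
        rw [hB]; exact Set.mem_insert _ _)
      rw [hB] at hyB
      rcases hyB with hy | hy
      · exact Or.inl hy
      · refine Or.inr ?_
        rw [hA]
        refine ⟨hy, ?_⟩
        rintro rfl
        exact hbJ (J.lower hyx haJ)
    · exact Or.inr (A.lower hyx hx)
  let I' : LowerSet P := ⟨insert a (A : Set P), hI'low⟩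
  have hI' : (I' : Set P) = insert a (A : Set P) := rfl
  have haA : a ∉ (A : Set P) := by
    rw [hA]; exact fun h => haI h.1
  have hAcard : (A : Set P).ncard + 1 = (I : Set P).ncard := by
    rw [hA]; exact Set.ncard_sdiff_singleton_add_one hbI
  have hI'card : (I' : Set P).ncard = (I : Set P).ncard := by
    rw [hI', Set.ncard_insert_of_notMem haA, hAcard]
  have hAI : (A : Set P) ⊆ I := by rw [hA]; exact Set.sdiff_subset
  have hswap : FlagSwap I I' := by
    refine flagSwap_of_le_of_le (A := A) (B := B) hAI ?_ ?_ ?_ hAcard ?_ hI'card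
    · exact Set.subset_insert _ _
    · change (I : Set P) ⊆ B
      rw [hB]; exact Set.subset_insert _ _
    · change (I' : Set P) ⊆ B
      rw [hB, hI']; exact Set.insert_subset_insert hAI
    · rw [hB, Set.ncard_insert_of_notMem haI]
  refine .head hswap (ih _ ?_ (hI'card.trans h) rfl)
  rw [← hn]
  refine Set.ncard_lt_ncard ⟨?_, fun hsub => (hsub ⟨haJ, haI⟩).2 (Set.mem_insert _ _)⟩
  rintro x ⟨hxJ, hxI'⟩
  refine ⟨hxJ, fun hxI => hxI' (Set.mem_insert_of_mem _ ?_)⟩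
  rw [hA]
  refine ⟨hxI, ?_⟩
  rintro rfl
  exact hbJ hxJ

theorem FlagSwap.ne_bot {α : Type*} [Preorder α] [OrderBot α] {x y : α} (h : FlagSwap x y)
    (hx : x ≠ ⊥) : y ≠ ⊥ := by
  rintro rfl
  obtain ⟨C, D, -, -, h⟩ := h
  exact (h.subset ⟨C.bot_mem, hx.symm⟩).2 rfl

theorem FlagSwap.ne_top {α : Type*} [Preorder α] [OrderTop α] {x y : α} (h : FlagSwap x y)
    (hx : x ≠ ⊤) : y ≠ ⊤ := by
  rintro rfl
  obtain ⟨C, D, -, -, h⟩ := h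
  exact (h.subset ⟨C.top_mem, hx.symm⟩).2 rfl

/-- The least and the greatest element lie in every maximal chain, so they are never exchanged, and a
path of exchanges between inner elements stays among inner elements. -/
theorem reflTransGen_flagSwap_inner {L : Type*} [DistribLattice L] [BoundedOrder L] {x y : L}
    (h : Relation.ReflTransGen FlagSwap x y) (hx : x ≠ ⊥ ∧ x ≠ ⊤) (hy : y ≠ ⊥ ∧ y ≠ ⊤) :
    Relation.ReflTransGen (fun a b : InnerElement L => FlagSwap (a : L) b) ⟨x, hx⟩ ⟨y, hy⟩ := by
  induction h using Relation.ReflTransGen.head_induction_on with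
  | refl => exact .refl
  | head hab _ ih => exact .head hab (ih ⟨hab.ne_bot hx.1, hab.ne_top hx.2⟩)

end LowerSet

/-! ### Dimension of the chain algebras -/

theorem natCard_innerElement_add_two (L : Type*) [DistribLattice L] [BoundedOrder L] [Finite L]
    [Nontrivial L] : Nat.card (InnerElement L) + 2 = Nat.card L := by
  have h := Set.ncard_add_ncard_compl ({⊥, ⊤} : Set L)
  rw [Set.ncard_pair bot_ne_top] at h
  have h' : Nat.card (InnerElement L) = ({⊥, ⊤} : Set L)ᶜ.ncard := by
    rw [← Nat.card_coe_set_eq]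
    exact Nat.card_congr (Equiv.subtypeEquivRight fun x => by simp)
  omega

theorem ringKrullDim_fullChainAlgebra_lowerSet (K : Type*) [Field K] (P : Type*) [PartialOrder P]
    [Finite P] : ringKrullDim (fullChainAlgebra K (LowerSet P)) =
      ((Nat.card (LowerSet P) - Nat.card P : ℕ) : WithBot ℕ∞) := by
  classical
  have := Fintype.ofFinite (LowerSet P)
  let c : Flag (LowerSet P) → Finset (LowerSet P) := fun C => (Set.toFinite {x | x ∈ C}).toFinset
  let r : LowerSet P → Fin (Nat.card P + 1) := fun I =>
    ⟨(I : Set P).ncard, Nat.lt_succ_of_le (Set.ncard_le_card _)⟩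
  have hc : ∀ C j, ∃! I, I ∈ c C ∧ r I = j := fun C j => by
    simpa [c, r, Fin.ext_iff] using C.existsUnique_ncard_eq (Nat.le_of_lt_succ j.2)
  have hconn : ∀ I J, r I = r J → Relation.ReflTransGen
      (fun x y => ∃ C D, x ∈ c C ∧ y ∈ c D ∧ (c C).erase x = (c D).erase y) I J := by
    intro I J h
    refine Relation.ReflTransGen.mono ?_ _ _
      (reflTransGen_flagSwap_of_ncard_eq (congrArg Fin.val h))
    rintro x y ⟨C, D, hx, hy, hCD⟩
    refine ⟨C, D, by simpa [c] using hx, by simpa [c] using hy, ?_⟩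
    apply Finset.coe_injective
    simpa [c] using hCD
  have key := ringKrullDim_monomialSubalgebra (K := K) hc hconn
  rw [Fintype.card_fin, Nat.add_sub_add_right, ← Nat.card_eq_fintype_card] at key
  exact key

theorem ringKrullDim_chainAlgebra_lowerSet (K : Type*) [Field K] (P : Type*) [PartialOrder P]
    [Finite P] (hP : 2 ≤ Nat.card P) : ringKrullDim (chainAlgebra K (LowerSet P)) =
      ((Nat.card (LowerSet P) - Nat.card P : ℕ) : WithBot ℕ∞) := by
  classical
  have : Nonempty P := (Nat.card_pos_iff.mp (by omega)).1
  have := Fintype.ofFinite (InnerElement (LowerSet P))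
  let c : Flag (LowerSet P) → Finset (InnerElement (LowerSet P)) := fun C =>
    (Set.toFinite {x : InnerElement (LowerSet P) | (x : LowerSet P) ∈ C}).toFinset
  have hpos : ∀ I : LowerSet P, 0 < (I : Set P).ncard ↔ I ≠ ⊥ := fun I => by
    rw [Nat.pos_iff_ne_zero, Ne, Set.ncard_eq_zero, LowerSet.coe_eq_empty]
  have hlt : ∀ I : LowerSet P, (I : Set P).ncard < Nat.card P ↔ I ≠ ⊤ := fun I => by
    rw [(Set.ncard_le_card _).lt_iff_ne, Ne, ← Set.eq_univ_iff_ncard, LowerSet.coe_eq_univ]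
  let r : InnerElement (LowerSet P) → Finset.Ioo 0 (Nat.card P) := fun I =>
    ⟨((I : LowerSet P) : Set P).ncard,
      Finset.mem_Ioo.mpr ⟨(hpos _).mpr I.2.1, (hlt _).mpr I.2.2⟩⟩
  have : Nonempty (Finset.Ioo 0 (Nat.card P)) := ⟨⟨1, Finset.mem_Ioo.mpr ⟨by omega, by omega⟩⟩⟩
  have hc : ∀ C j, ∃! I, I ∈ c C ∧ r I = j := by
    rintro C ⟨k, hk⟩
    obtain ⟨hk0, hkn⟩ := Finset.mem_Ioo.mp hk
    obtain ⟨I, ⟨hI, rfl⟩, huniq⟩ := C.existsUnique_ncard_eq hkn.le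
    refine ⟨⟨I, (hpos I).mp hk0, (hlt I).mp hkn⟩, ⟨by simpa [c] using hI, rfl⟩, ?_⟩
    rintro J ⟨hJ, hJr⟩
    exact Subtype.ext (huniq J ⟨by simpa [c] using hJ, congrArg Subtype.val hJr⟩)
  have hconn : ∀ I J, r I = r J → Relation.ReflTransGen
      (fun x y => ∃ C D, x ∈ c C ∧ y ∈ c D ∧ (c C).erase x = (c D).erase y) I J := by
    intro I J h
    refine Relation.ReflTransGen.mono ?_ _ _ (reflTransGen_flagSwap_inner
      (reflTransGen_flagSwap_of_ncard_eq (congrArg Subtype.val h)) I.2 J.2)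
    rintro x y ⟨C, D, hx, hy, hCD⟩
    refine ⟨C, D, by simpa [c] using hx, by simpa [c] using hy, ?_⟩
    ext z
    have := Set.ext_iff.mp hCD z
    simpa [c, Subtype.ext_iff, and_comm] using this
  have key := ringKrullDim_monomialSubalgebra (K := K) hc hconn
  have : Nontrivial (LowerSet P) := ⟨⊤, ⊥, (hpos ⊤).mp (by simp)⟩
  have hcard := natCard_innerElement_add_two (LowerSet P)
  rw [Nat.card_eq_fintype_card] at hcard
  rw [Fintype.card_coe, Nat.card_Ioo] at key
  have hdim : Nat.card (LowerSet P) - Nat.card P =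
      Fintype.card (InnerElement (LowerSet P)) + 1 - (Nat.card P - 0 - 1) := by omega
  rw [hdim]
  exact key

theorem theorem2p3 (K : Type*) [Field K] (P : Type*) [PartialOrder P] [Finite P] :
    (2 ≤ Nat.card P →
      ringKrullDim (chainAlgebra K (LowerSet P)) =
        ((Nat.card (LowerSet P) - Nat.card P : ℕ) : WithBot ℕ∞)) ∧
    ringKrullDim (fullChainAlgebra K (LowerSet P)) =
      ((Nat.card (LowerSet P) - Nat.card P : ℕ) : WithBot ℕ∞) :=
  ⟨ringKrullDim_chainAlgebra_lowerSet K P, ringKrullDim_fullChainAlgebra_lowerSet K P⟩
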